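/- Let $n\ge 1$, let $\Omega\subseteq\mathbb R^n$ be a non-empty bounded open set and let $f:\Omega\to\mathbb R^n$ be continuous. A function $\psi:\mathbb R^n\to\mathbb R$ is called quasi-convex if $\{y:\psi(y)\le r\}$ is convex for every $r\in\mathbb R$. We say that $f$ satisfies the convex hull-like property in $\Omega$ if for every continuous quasi-convex function $\psi:\mathbb R^n\to\mathbb R$ there exists $x^*\in\partial\Omega$ such that $$\limsup_{x\to x^*,\,x\in\Omega}\psi(f(x))=\sup_{x\in\Omega}\psi(f(x)),$$ both sides being elements of $[-\infty,+\infty]$. Then at least one of the following assertions holds. (1) $f$ satisfies the convex hull-like property in $\Omega$. (2) There exists a non-empty open set $X\subseteq\Omega$ with $\overline X\subseteq\Omega$ such that for every continuous function $g:\Omega\to\mathbb R^n$ there exists $\tilde\lambda\ge 0$ such that, for each $\lambda>\tilde\lambda$, there exist $\hat x\in X$ and two sequences $\{y_k\}$, $\{z_k\}$ in $\mathbb R^n$ with $$\lim_{k\to\infty}y_k=\lim_{k\to\infty}z_k=g(\hat x)+\lambda f(\hat x)$$ such that, for each $k\in\mathbb N$, the equation $g(x)+\lambda f(x)=y_k$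 has no solution in $X$, while the equation $g(x)+\lambda f(x)=z_k$ has two distinct solutions $u_k,v_k$ in $X$, and these can be chosen so that $$\lim_{k\to\infty}u_k=\lim_{k\to\infty}v_k=\hat x.$$ -/

import Mathlib

open Set Filter Topology

/-- The convex hull-like property in `Ω` of a (continuous) function `f` defined on `Ω`: for every
continuous quasi-convex `ψ : Y → ℝ` there is a boundary point of `Ω` at which the upper limit of
`ψ ∘ f` (along points of `Ω`) equals the supremum of `ψ ∘ f` over `Ω`. Both the upper limit and the
supremum are taken in the extended reals, since they may be infinite. -/
def ConvexHullLikeProperty {E Y : Type*} [TopologicalSpace E] [AddCommGroup Y] [Module ℝ Y]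
    [TopologicalSpace Y] (Ω : Set E) (f : E → Y) : Prop :=
  ∀ ψ : Y → ℝ, Continuous ψ → QuasiconvexOn ℝ Set.univ ψ →
    ∃ xstar ∈ frontier Ω,
      Filter.limsup (fun x => ((ψ (f x) : ℝ) : EReal)) (𝓝[Ω] xstar)
        = ⨆ x ∈ Ω, ((ψ (f x) : ℝ) : EReal)

/-!
Suppose that the convex hull-like property fails for a continuous quasi-convex `ψ`. By compactness
of `∂Ω` there is a level `r < sup ψ ∘ f` with `ψ ∘ f < r` near `∂Ω`
(`exists_level_of_limsup_ne_iSup`). The open set `X = {x ∈ Ω | ψ (f x) > r}` then has closure inside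
`Ω`, and `f` maps `∂X` into the closed convex set `C = {ψ ≤ r}` and some point `x₀` of `X` outside
`C`. By Hahn–Banach a linear functional `φ` is larger at `f x₀` than on `f (∂X)`
(`exists_separating_functional_of_not_convexHullLike`). For `g` continuous, hence bounded on the
compact set `closure X`, the same strict inequality holds for `h = g + λ f` once `λ` is large, so
`φ ∘ h` attains its maximum over `closure X` at a point `p` of `X`
(`exists_forall_gt_exists_isMaxOn`).

This `p` is the required point. Moving from `h p` in a direction in which `φ` increases gives values
outside `h '' X`, so `h` is not locally open at `p`; by invariance of domain `h` is then not
injective on any neighbourhood of `p`, which gives the pairs of points with a common value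
(`exists_seq_of_isMaxOn`).

Invariance of domain (`image_mem_nhds_of_continuousOn_of_injOn`) is deduced from Brouwer's theorem,
which is used in the form that a map close to the identity of the unit ball has a zero
(`exists_eq_zero_of_norm_sub_le`). That in turn reduces by smoothing to the absence of a `C¹`
retraction `r` of the ball onto the sphere, proved by the analytic argument of Milnor and Rogers:
for `q = r - id`, the integral of `det (1 + t • Dq)` over the ball is a polynomial in `t`, equal to
the volume of the ball for small `t ≥ 0`, hence for `t = 1`, where the determinant vanishes
(`not_contDiff_retraction_sphere`).
-/

/-! ### Brouwer's theorem in the form of a no-retraction statement -/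

/-- The determinant of `1 + t • A` is a polynomial in `t` of degree at most `dim E`. -/
theorem exists_polynomial_eval_eq_det_one_add_smul {E : Type*} [NormedAddCommGroup E]
    [NormedSpace ℝ E] [FiniteDimensional ℝ E] (A : E →L[ℝ] E) :
    ∃ P : Polynomial ℝ, P.natDegree ≤ Module.finrank ℝ E ∧
      ∀ t : ℝ, P.eval t = (1 + t • A).det := by
  set b := Module.finBasis ℝ E
  set M := LinearMap.toMatrix b b (A : E →ₗ[ℝ] E) with hM
  refine ⟨((Polynomial.X : Polynomial ℝ) • M.map Polynomial.C +
    (1 : Matrix _ _ ℝ).map Polynomial.C).det, ?_, fun t => ?_⟩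
  · simpa using Polynomial.natDegree_det_X_add_C_le M 1
  · have h1 : (1 + t • A).det = (1 + t • M).det := by
      rw [ContinuousLinearMap.det, ← LinearMap.det_toMatrix b]
      congr 1
      simp [hM, LinearMap.toMatrix_one]
    rw [h1, ← Polynomial.coe_evalRingHom, RingHom.map_det]
    congr 1
    ext i j
    by_cases hij : i = j <;> simp [hij] <;> ring

/-- The extension by zero of a `C¹` map on the closed unit ball that vanishes on the unit sphere
is Lipschitz. -/
theorem exists_lipschitzWith_indicator_closedBall {E : Type*} [NormedAddCommGroup E]
    [NormedSpace ℝ E] [FiniteDimensional ℝ E] {q : E → E} (hq : ContDiff ℝ 1 q)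
    (h0 : ∀ x, ‖x‖ = 1 → q x = 0) :
    ∃ K, LipschitzWith K ((Metric.closedBall (0 : E) 1).indicator q) := by
  obtain ⟨K, hK⟩ := (hq.contDiffOn (s := Metric.closedBall (0 : E) 1)).exists_lipschitzOnWith
    one_ne_zero (convex_closedBall _ _) (isCompact_closedBall _ _)
  have mixed : ∀ x y : E, ‖x‖ ≤ 1 → 1 < ‖y‖ → ‖q x‖ ≤ K * dist x y := by
    intro x y hx hy
    -- the segment from `x` to `y` meets the unit sphere, where `q` vanishes
    obtain ⟨z, hz, hz1⟩ : ∃ z ∈ segment ℝ x y, ‖z‖ = 1 :=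
      (convex_segment x y).isPreconnected.intermediate_value (left_mem_segment ℝ x y)
        (right_mem_segment ℝ x y) continuous_norm.continuousOn ⟨hx, hy.le⟩
    have h1 := hK.dist_le_mul x (by simpa using hx) z (by simp [hz1])
    rw [h0 z hz1, dist_zero_right] at h1
    have h2 := dist_add_dist_of_mem_segment hz
    have h3 : dist x z ≤ dist x y := by linarith [dist_nonneg (x := z) (y := y)]
    exact h1.trans (by gcongr)
  refine ⟨K, LipschitzWith.of_dist_le_mul fun x y => ?_⟩
  by_cases hx : ‖x‖ ≤ 1 <;> by_cases hy : ‖y‖ ≤ 1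
  · have hx' : x ∈ Metric.closedBall (0 : E) 1 := by simpa using hx
    have hy' : y ∈ Metric.closedBall (0 : E) 1 := by simpa using hy
    rw [indicator_of_mem hx', indicator_of_mem hy']
    exact hK.dist_le_mul x hx' y hy'
  · rw [indicator_of_mem (by simpa using hx), indicator_of_notMem (by simpa using hy),
      dist_zero_right]
    exact mixed x y hx (not_le.1 hy)
  · rw [indicator_of_notMem (by simpa using hx), indicator_of_mem (by simpa using hy),
      dist_zero_left, dist_comm]
    exact mixed y x hy (not_le.1 hx)
  · rw [indicator_of_notMem (by simpa using hx), indicator_of_notMem (by simpa using hy), dist_self]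
    positivity

/-- A small Lipschitz perturbation of the identity that does not move the complement of a set `s`
maps `s` bijectively onto itself. -/
theorem injective_and_image_eq_of_lipschitzWith {E : Type*} [NormedAddCommGroup E]
    [NormedSpace ℝ E] [CompleteSpace E] {p : E → E} {K : NNReal} (hK : K < 1)
    (hp : LipschitzWith K p) {s : Set E} (hs : ∀ x ∉ s, p x = 0) :
    Function.Injective (fun x => x + p x) ∧ (fun x => x + p x) '' s = s := by
  have hinj : Function.Injective (fun x => x + p x) := by
    intro x y hxy
    simp only at hxy
    have h1 : dist x y = dist (p x) (p y) := by
      rw [dist_comm (p x), dist_eq_norm, dist_eq_norm, sub_eq_sub_iff_add_eq_add.2]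
      rw [hxy, add_comm]
    have h2 := hp.dist_le_mul x y
    by_contra hne
    have h3 : 0 < dist x y := dist_pos.2 hne
    have h4 : (K : ℝ) < 1 := by exact_mod_cast hK
    nlinarith
  refine ⟨hinj, Subset.antisymm ?_ ?_⟩
  · rintro _ ⟨x, hx, rfl⟩
    by_contra hxs
    -- the point `x + p x ∉ s` is fixed, so it coincides with `x` by injectivity
    have h1 : x + p x = x := hinj (by simp [hs _ hxs])
    exact hxs (by simpa [h1] using hx)
  · intro y hy
    have hc : ContractingWith K (fun x => y - p x) :=
      ⟨hK, LipschitzWith.of_dist_le_mul fun a b => by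
        rw [dist_sub_left]; exact hp.dist_le_mul a b⟩
    have hfix : y - p (hc.fixedPoint _) = hc.fixedPoint _ := hc.fixedPoint_isFixedPt
    set x := hc.fixedPoint _
    have hx : x + p x = y := (sub_eq_iff_eq_add.1 hfix).symm
    refine ⟨x, ?_, hx⟩
    by_contra hxs
    rw [hs x hxs, add_zero] at hx
    exact hxs (hx ▸ hy)

/-- If a `C¹` map `q` vanishes on the unit sphere, then the Jacobian of `id + q` integrates over the
unit ball to the volume of the ball. -/
theorem setIntegral_det_one_add_fderiv {E : Type*} [NormedAddCommGroup E]
    [NormedSpace ℝ E] [FiniteDimensional ℝ E] [MeasurableSpace E] [BorelSpace E]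
    (μ : MeasureTheory.Measure E) [μ.IsAddHaarMeasure] {q : E → E} (hq : ContDiff ℝ 1 q)
    (h0 : ∀ x, ‖x‖ = 1 → q x = 0) :
    ∫ x in Metric.ball (0 : E) 1, (1 + fderiv ℝ q x).det ∂μ = μ.real (Metric.ball 0 1) := by
  have hcont : Continuous (fderiv ℝ q) := hq.continuous_fderiv one_ne_zero
  obtain ⟨K, hK⟩ := exists_lipschitzWith_indicator_closedBall hq h0
  set p := (Metric.closedBall (0 : E) 1).indicator q with hp
  have hpq : ∀ x ∈ Metric.ball (0 : E) 1, p x = q x := fun x hx =>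
    indicator_of_mem (Metric.ball_subset_closedBall hx) q
  have hp0 : ∀ x ∉ Metric.ball (0 : E) 1, p x = 0 := by
    intro x hx
    by_cases h : x ∈ Metric.closedBall (0 : E) 1
    · rw [hp, indicator_of_mem h]
      refine h0 x (le_antisymm (by simpa using h) (by simpa using hx))
    · exact indicator_of_notMem h q
  -- for small `t`, the map `id + t • q` is a diffeomorphism of the ball with positive Jacobian
  obtain ⟨δ, hδ, hdet⟩ : ∃ δ > 0, ∀ B : E →L[ℝ] E, ‖B‖ < δ → 0 < (1 + B).det := by
    have hc : Continuous fun B : E →L[ℝ] E => (1 + B).det :=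
      ContinuousLinearMap.continuous_det.comp (continuous_const.add continuous_id)
    have h1 : (0 : ℝ) < (1 + (0 : E →L[ℝ] E)).det := by
      simp [ContinuousLinearMap.det]
    obtain ⟨δ, hδ, h⟩ := Metric.eventually_nhds_iff.1 (hc.continuousAt.eventually_const_lt h1)
    exact ⟨δ, hδ, fun B hB => h (by simpa using hB)⟩
  obtain ⟨C, hC⟩ := (isCompact_closedBall (0 : E) 1).exists_bound_of_continuousOn
    hcont.continuousOn
  obtain ⟨ε, hε, hεK, hεC⟩ : ∃ ε : ℝ, 0 < ε ∧ ε * (K + 1) ≤ 1 ∧ ε * (|C| + 1) ≤ δ := by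
    refine ⟨min (1 / (K + 1)) (δ / (|C| + 1)), by positivity, ?_, ?_⟩
    · rw [← le_div_iff₀ (by positivity)]; exact min_le_left _ _
    · rw [← le_div_iff₀ (by positivity)]; exact min_le_right _ _
  have small : ∀ t : ℝ, 0 ≤ t → t < ε →
      ∫ x in Metric.ball (0 : E) 1, (1 + t • fderiv ℝ q x).det ∂μ
        = μ.real (Metric.ball 0 1) := by
    intro t ht0 ht
    have hlip : LipschitzWith (t.toNNReal * K) (fun x => t • p x) := by
      refine LipschitzWith.of_dist_le_mul fun x y => ?_
      rw [dist_smul₀, NNReal.coe_mul, Real.coe_toNNReal _ ht0, mul_assoc, Real.norm_of_nonneg ht0]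
      exact mul_le_mul_of_nonneg_left (hK.dist_le_mul x y) ht0
    have hlt : t.toNNReal * K < 1 := by
      rw [← NNReal.coe_lt_coe, NNReal.coe_mul, Real.coe_toNNReal _ ht0, NNReal.coe_one]
      nlinarith [K.coe_nonneg]
    obtain ⟨hinj, himg⟩ := injective_and_image_eq_of_lipschitzWith hlt hlip
      (s := Metric.ball (0 : E) 1) (fun x hx => by simp [hp0 x hx])
    have hEq : EqOn (fun x => x + t • q x) (fun x => x + t • p x) (Metric.ball (0 : E) 1) :=
      fun x hx => by simp [hpq x hx]
    have hder : ∀ x ∈ Metric.ball (0 : E) 1, HasFDerivWithinAt (fun x => x + t • q x)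
        (1 + t • fderiv ℝ q x) (Metric.ball (0 : E) 1) x := fun x _ =>
      ((hasFDerivAt_id x).add (((hq.differentiable one_ne_zero) x).hasFDerivAt.const_smul
        t)).hasFDerivWithinAt
    have key := MeasureTheory.integral_image_eq_integral_abs_det_fderiv_smul μ
      measurableSet_ball hder (hEq.injOn_iff.2 hinj.injOn) (fun _ => (1 : ℝ))
    rw [hEq.image_eq, himg] at key
    simp only [smul_eq_mul, mul_one, MeasureTheory.integral_const, MeasurableSet.univ,
      MeasureTheory.measureReal_restrict_apply, univ_inter] at key
    rw [key]
    refine MeasureTheory.setIntegral_congr_fun measurableSet_ball fun x hx => ?_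
    refine (abs_of_pos (hdet _ ?_)).symm
    have h1 := hC x (Metric.ball_subset_closedBall hx)
    rw [norm_smul, Real.norm_of_nonneg ht0]
    have h2 : ‖fderiv ℝ q x‖ ≤ |C| := h1.trans (le_abs_self C)
    nlinarith [norm_nonneg (fderiv ℝ q x)]
  -- Lagrange interpolation at `dim E + 1` small nodes carries the equality over to `t = 1`
  set d := Module.finrank ℝ E
  set s := Finset.range (d + 1)
  set v : ℕ → ℝ := fun i => ε * (i / (d + 1)) with hv
  have hvinj : InjOn v s := by
    intro i _ j _ hij
    have : (i : ℝ) = j := by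
      have h2 : (d : ℝ) + 1 ≠ 0 := by positivity
      simpa [hv, hε.ne', h2, div_left_inj'] using hij
    exact_mod_cast this
  have hvlt : ∀ i ∈ s, 0 ≤ v i ∧ v i < ε := by
    intro i hi
    have hi' : (i : ℝ) < d + 1 := by exact_mod_cast Finset.mem_range.1 hi
    refine ⟨by positivity, ?_⟩
    have : (i : ℝ) / (d + 1) < 1 := (div_lt_one (by positivity)).2 hi'
    simp only [hv]
    nlinarith
  set w : ℕ → ℝ := fun i => (Lagrange.basis s v i).eval 1 with hw
  have hw1 : ∑ i ∈ s, w i = 1 := by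
    have := congrArg (Polynomial.eval 1) (Lagrange.sum_basis hvinj ⟨0, by simp [s]⟩)
    simpa [Polynomial.eval_finsetSum] using this
  have hinterp : ∀ A : E →L[ℝ] E, (1 + A).det = ∑ i ∈ s, w i * (1 + v i • A).det := by
    intro A
    obtain ⟨P, hdeg, hP⟩ := exists_polynomial_eval_eq_det_one_add_smul A
    have h1 := Lagrange.eq_interpolate (f := P) hvinj (by
      refine lt_of_le_of_lt Polynomial.degree_le_natDegree ?_
      rw [Finset.card_range]
      exact_mod_cast Nat.lt_succ_of_le hdeg)
    have h2 := congrArg (Polynomial.eval 1) h1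
    rw [hP, Lagrange.interpolate_apply, Polynomial.eval_finsetSum, one_smul] at h2
    rw [h2]
    refine Finset.sum_congr rfl fun i _ => ?_
    rw [Polynomial.eval_mul, Polynomial.eval_C, hP, mul_comm]
  have hint : ∀ i ∈ s, MeasureTheory.Integrable
      (fun x => w i * (1 + v i • fderiv ℝ q x).det) (μ.restrict (Metric.ball (0 : E) 1)) := by
    intro i _
    have hc : Continuous fun x => w i * (1 + v i • fderiv ℝ q x).det :=
      continuous_const.mul (ContinuousLinearMap.continuous_det.comp
        (continuous_const.add (hcont.const_smul (v i))))
    exact (hc.continuousOn.integrableOn_compact (isCompact_closedBall (0 : E) 1)).mono_set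
      Metric.ball_subset_closedBall
  simp only [fun x => hinterp (fderiv ℝ q x)]
  rw [MeasureTheory.integral_finsetSum _ hint]
  simp_rw [MeasureTheory.integral_const_mul]
  rw [Finset.sum_congr rfl fun i hi => by rw [small (v i) (hvlt i hi).1 (hvlt i hi).2],
    ← Finset.sum_mul, hw1, one_mul]

/-- There is no `C¹` map into the unit sphere that is the identity on the sphere: its Jacobian would
vanish identically, while its integral over the ball would be the volume of the ball. -/
theorem not_contDiff_retraction_sphere {E : Type*} [NormedAddCommGroup E]
    [InnerProductSpace ℝ E] [FiniteDimensional ℝ E] {r : E → E} (hr : ContDiff ℝ 1 r)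
    (hnorm : ∀ x, ‖r x‖ = 1) (hid : ∀ x, ‖x‖ = 1 → r x = x) : False := by
  borelize E
  have hdet : ∀ x, (fderiv ℝ r x).det = 0 := by
    intro x
    have hd := (hr.differentiable one_ne_zero x).hasFDerivAt
    have horth : ∀ v, inner ℝ (r x) (fderiv ℝ r x v) = (0 : ℝ) := by
      intro v
      have h1 := hd.inner ℝ hd
      have h2 : (fun t => inner ℝ (r t) (r t)) = fun _ => (1 : ℝ) := by
        funext t
        simp [hnorm]
      rw [h2] at h1
      have h3 := congrArg (fun L => L v) (h1.unique (hasFDerivAt_const (1 : ℝ) x))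
      simp [real_inner_comm] at h3
      linarith
    by_contra hne
    have hunit : IsUnit (fderiv ℝ r x : E →ₗ[ℝ] E) :=
      (LinearMap.isUnit_iff_isUnit_det _).2 (isUnit_iff_ne_zero.2 hne)
    obtain ⟨v, hv⟩ := LinearMap.range_eq_top.1 ((LinearMap.isUnit_iff_range_eq_top _).1 hunit) (r x)
    have h4 := horth v
    have h5 : fderiv ℝ r x v = r x := hv
    rw [h5, real_inner_self_eq_norm_sq, hnorm] at h4
    norm_num at h4
  have hq : ContDiff ℝ 1 fun x => r x - x := hr.sub contDiff_id
  have key := setIntegral_det_one_add_fderiv (MeasureTheory.Measure.addHaar (G := E)) hq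
    (fun x hx => by simp [hid x hx])
  have hfd : ∀ x, 1 + fderiv ℝ (fun x => r x - x) x = fderiv ℝ r x := by
    intro x
    rw [fderiv_fun_sub (hr.differentiable one_ne_zero x) differentiableAt_fun_id, fderiv_fun_id,
      ContinuousLinearMap.one_def, add_sub_cancel]
  simp_rw [hfd, hdet] at key
  rw [MeasureTheory.integral_zero] at key
  exact (ENNReal.toReal_pos (Metric.measure_ball_pos _ (0 : E) one_pos).ne'
    MeasureTheory.measure_ball_lt_top.ne).ne key

/-! ### Invariance of domain -/

open scoped Manifold ContDiff in
/-- A continuous map between finite-dimensional spaces is a uniform limit of `C¹` maps. -/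
theorem exists_contDiff_forall_dist_lt {E F : Type*} [NormedAddCommGroup E] [NormedSpace ℝ E]
    [FiniteDimensional ℝ E] [NormedAddCommGroup F] [NormedSpace ℝ F] {G : E → F}
    (hG : Continuous G) {ε : ℝ} (hε : 0 < ε) :
    ∃ P : E → F, ContDiff ℝ 1 P ∧ ∀ x, dist (P x) (G x) < ε := by
  obtain ⟨g, hg⟩ := exists_contMDiffMap_forall_mem_convex_of_local_const (n := 1) 𝓘(ℝ, E)
    (t := fun x => Metric.ball (G x) ε) (fun x => convex_ball _ _) (fun x => ⟨G x, by
      filter_upwards [hG.continuousAt.eventually (Metric.ball_mem_nhds (G x) hε)] with y hy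
      rw [Metric.mem_ball, dist_comm]
      exact hy⟩)
  exact ⟨g, contMDiff_iff_contDiff.1 g.contMDiff, hg⟩

/-- A continuous map that stays close to the identity on the closed unit ball has a zero there. -/
theorem exists_eq_zero_of_norm_sub_le {E : Type*} [NormedAddCommGroup E]
    [InnerProductSpace ℝ E] [FiniteDimensional ℝ E] {F : E → E}
    (hF : ContinuousOn F (Metric.closedBall 0 1)) (hclose : ∀ x, ‖x‖ ≤ 1 → ‖F x - x‖ ≤ 1 / 4) :
    ∃ x, ‖x‖ ≤ 1 ∧ F x = 0 := by
  by_contra! hne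
  obtain ⟨G, hG⟩ := ContinuousMap.exists_restrict_eq (Metric.isClosed_closedBall (x := (0 : E))
    (ε := 1)) ⟨_, hF.domRestrict⟩
  have hGF : ∀ x, ‖x‖ ≤ 1 → G x = F x := fun x hx =>
    congrArg (fun g => g ⟨x, by simpa using hx⟩) hG
  obtain ⟨x₀, hx₀, hmin⟩ := (isCompact_closedBall (0 : E) 1).exists_isMinOn
    ⟨0, by simp⟩ hF.norm
  have hδ : 0 < ‖F x₀‖ := norm_pos_iff.2 (hne x₀ (by simpa using hx₀))
  obtain ⟨P, hP, hPG⟩ := exists_contDiff_forall_dist_lt G.continuous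
    (lt_min hδ (by norm_num : (0 : ℝ) < 1 / 4))
  have hP0 : ∀ x, ‖x‖ ≤ 1 → P x ≠ 0 := by
    intro x hx h0
    have h1 := (hPG x).trans_le (min_le_left _ _)
    rw [h0, hGF x hx, dist_zero_left] at h1
    exact absurd (hmin (show x ∈ Metric.closedBall 0 1 by simpa using hx)) (not_le.2 h1)
  have hPx : ∀ x, ‖x‖ ≤ 1 → ‖P x - x‖ < 1 / 2 := by
    intro x hx
    have h1 := (hPG x).trans_le (min_le_right _ _)
    rw [hGF x hx, dist_eq_norm] at h1
    have h2 := norm_add_le (P x - F x) (F x - x)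
    rw [sub_add_sub_cancel] at h2
    linarith [hclose x hx]
  -- interpolate between `P` near the centre and the identity near the sphere, without zeros
  let b : ContDiffBump (0 : E) := ⟨1 / 2, 1, by norm_num, by norm_num⟩
  set Q : E → E := fun x => x + b x • (P x - x) with hQ
  have hQd : ContDiff ℝ 1 Q := contDiff_id.add (b.contDiff.smul (hP.sub contDiff_id))
  have hQ1 : ∀ x, 1 ≤ ‖x‖ → Q x = x := by
    intro x hx
    simp [hQ, b.zero_of_le_dist (x := x) (by simpa using hx)]
  have hQ0 : ∀ x, Q x ≠ 0 := by
    intro x h0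
    rcases le_total 1 ‖x‖ with hx | hx
    · rw [hQ1 x hx] at h0
      simp [h0] at hx
      linarith
    rcases le_or_gt ‖x‖ (1 / 2) with hx2 | hx2
    · have : b x = 1 := b.one_of_mem_closedBall (by simpa [b] using hx2)
      simp [hQ, this] at h0
      exact hP0 x hx h0
    · have h1 : ‖b x • (P x - x)‖ = ‖x‖ := by
        rw [← norm_neg x, ← eq_neg_of_add_eq_zero_right h0]
      rw [norm_smul, Real.norm_of_nonneg b.nonneg] at h1
      nlinarith [hPx x hx, b.le_one (x := x), b.nonneg (x := x), norm_nonneg (P x - x)]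
  refine not_contDiff_retraction_sphere (r := fun x => ‖Q x‖⁻¹ • Q x)
    (((hQd.norm ℝ hQ0).inv fun x => norm_ne_zero_iff.2 (hQ0 x)).smul hQd) (fun x => ?_)
    fun x hx => ?_
  · rw [norm_smul, norm_inv, norm_norm, inv_mul_cancel₀ (norm_ne_zero_iff.2 (hQ0 x))]
  · simp [hQ1 x hx.ge, hx]

/-- **Invariance of domain** for the unit ball: an injective continuous map on the closed unit ball
sends the centre to an interior point of the image. If it did not, then a left inverse `G` of `h`
could be modified near `h 0` so as to lose its only zero on the image: push the image radially away
from a nearby point `c` outside it, and perturb `G` so as to have no zero on a small sphere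
around `c`. The modification composed with `h` is close to the identity and has no zero. -/
theorem mem_interior_image_unit_closedBall {E : Type*} [NormedAddCommGroup E]
    [InnerProductSpace ℝ E] [FiniteDimensional ℝ E] {h : E → E}
    (hc : ContinuousOn h (Metric.closedBall 0 1)) (hinj : InjOn h (Metric.closedBall 0 1)) :
    h 0 ∈ interior (h '' Metric.closedBall 0 1) := by
  borelize E
  by_contra hnot
  set B := Metric.closedBall (0 : E) 1 with hB
  have hBc : IsCompact B := isCompact_closedBall _ _
  have : CompactSpace B := isCompact_iff_compactSpace.1 hBc
  have h0B : (0 : E) ∈ B := by simp [hB]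
  obtain ⟨G, hG⟩ : ∃ G : C(E, E), ∀ x ∈ B, G (h x) = x := by
    have he := hc.domRestrict.isClosedEmbedding hinj.injective
    obtain ⟨G, hG⟩ := ContinuousMap.exists_extension he ⟨Subtype.val, continuous_subtype_val⟩
    exact ⟨G, fun x hx => congrArg (fun g => g ⟨x, hx⟩) hG⟩
  obtain ⟨ε, hε, hGε⟩ : ∃ ε > 0, ∀ y, dist y (h 0) < 3 * ε → ‖G y‖ < 1 / 16 := by
    have h1 : ‖G (h 0)‖ < 1 / 16 := by rw [hG 0 h0B]; norm_num
    obtain ⟨δ, hδ, h2⟩ := Metric.eventually_nhds_iff.1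
      (G.continuous.norm.continuousAt.eventually_lt_const h1)
    exact ⟨δ / 3, by positivity, fun y hy => h2 (by linarith)⟩
  obtain ⟨c, hcε, hcK⟩ : ∃ c, dist c (h 0) < ε ∧ c ∉ h '' B := by
    by_contra! hall
    exact hnot (mem_interior_iff_mem_nhds.2 (mem_of_superset (Metric.ball_mem_nhds _ hε)
      fun c hc => hall c hc))
  -- away from `c` the left inverse `G` is bounded below on the image
  obtain ⟨δ, hδ, hδG⟩ : ∃ δ > 0, ∀ x ∈ B, ε ≤ dist (h x) c → δ ≤ ‖x‖ := by
    obtain ⟨δ, hδ, h1⟩ := Metric.continuousWithinAt_iff.1 (hc 0 h0B) (ε - dist c (h 0))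
      (by linarith)
    refine ⟨δ, hδ, fun x hx hxc => ?_⟩
    by_contra! hlt
    have h2 := h1 hx (by simpa using hlt)
    have h3 := dist_triangle (h x) (h 0) c
    rw [dist_comm (h 0) c] at h3
    linarith
  set m := min δ (1 / 16) with hm
  have hm0 : 0 < m := lt_min hδ (by norm_num)
  obtain ⟨P, hP, hPG⟩ := exists_contDiff_forall_dist_lt G.continuous (half_pos hm0)
  -- the image of a sphere under a `C¹` map is a null set, so it misses a small vector
  obtain ⟨w, hw, hwP⟩ : ∃ w, ‖w‖ < m / 2 ∧ ∀ y ∈ Metric.sphere c ε, P y ≠ w := by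
    by_contra! hall
    have hnull : MeasureTheory.Measure.addHaar (G := E) (P '' Metric.sphere c ε) = 0 :=
      MeasureTheory.addHaar_image_eq_zero_of_differentiableOn_of_addHaar_eq_zero _
        (hP.differentiable one_ne_zero).differentiableOn
        (MeasureTheory.Measure.addHaar_sphere_of_ne_zero _ c hε.ne')
    refine (Metric.measure_ball_pos (MeasureTheory.Measure.addHaar (G := E)) (0 : E)
      (half_pos hm0)).ne' (MeasureTheory.measure_mono_null (fun w hw => ?_) hnull)
    exact hall w (by simpa using hw)
  set Φ : E → E := fun y => c + (max (ε / dist y c) 1) • (y - c) with hΦ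
  have hdist : ∀ x ∈ B, 0 < dist (h x) c := fun x hx =>
    dist_pos.2 fun h1 => hcK (h1 ▸ mem_image_of_mem h hx)
  have hΦfar : ∀ x ∈ B, ε ≤ dist (h x) c → Φ (h x) = h x := by
    intro x hx hxc
    have h1 : ε / dist (h x) c ≤ 1 := (div_le_one (hdist x hx)).2 hxc
    simp [hΦ, max_eq_right h1]
  have hΦnear : ∀ x ∈ B, dist (h x) c < ε → Φ (h x) ∈ Metric.sphere c ε := by
    intro x hx hxc
    have h0 := hdist x hx
    have h1 : 1 ≤ ε / dist (h x) c := (one_le_div h0).2 hxc.le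
    rw [mem_sphere_iff_norm]
    simp only [hΦ, max_eq_left h1, add_sub_cancel_left]
    rw [norm_smul, ← dist_eq_norm, Real.norm_of_nonneg (by positivity), div_mul_cancel₀ _ h0.ne']
  obtain ⟨x, hx, hx0⟩ := exists_eq_zero_of_norm_sub_le (F := fun x => P (Φ (h x)) - w) (by
      refine (hP.continuous.comp_continuousOn ?_).sub continuousOn_const
      refine continuousOn_const.add (ContinuousOn.smul ?_ (hc.sub continuousOn_const))
      exact (continuousOn_const.div (continuous_id.dist continuous_const |>.comp_continuousOn hc)
        fun x hx => (hdist x hx).ne').sup continuousOn_const) (by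
      intro x hx
      have hxB : x ∈ B := by simpa [hB] using hx
      have h1 := hPG (Φ (h x))
      rw [dist_eq_norm] at h1
      have hm1 : m ≤ 1 / 16 := min_le_right _ _
      have h2 : ‖G (Φ (h x)) - x‖ ≤ 1 / 8 := by
        rcases le_or_gt ε (dist (h x) c) with hxc | hxc
        · rw [hΦfar x hxB hxc, hG x hxB, sub_self, norm_zero]
          norm_num
        · have h3 : dist (Φ (h x)) c = ε := hΦnear x hxB hxc
          have h4 := hGε (Φ (h x)) (by linarith [dist_triangle (Φ (h x)) c (h 0)])
          have h5 := hGε (h x) (by linarith [dist_triangle (h x) c (h 0)])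
          rw [hG x hxB] at h5
          linarith [norm_sub_le (G (Φ (h x))) x]
      calc ‖P (Φ (h x)) - w - x‖
          = ‖(P (Φ (h x)) - G (Φ (h x))) + (G (Φ (h x)) - x) - w‖ := by congr 1; abel
        _ ≤ ‖P (Φ (h x)) - G (Φ (h x))‖ + ‖G (Φ (h x)) - x‖ + ‖w‖ :=
          (norm_sub_le _ _).trans (by gcongr; exact norm_add_le _ _)
        _ ≤ 1 / 4 := by linarith)
  have hxB : x ∈ B := by simpa [hB] using hx
  have hPw : P (Φ (h x)) = w := sub_eq_zero.1 hx0
  rcases le_or_gt ε (dist (h x) c) with hxc | hxc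
  · have h1 := hPG (h x)
    rw [hΦfar x hxB hxc] at hPw
    rw [hPw, hG x hxB, dist_eq_norm] at h1
    have h2 := norm_sub_norm_le x w
    rw [norm_sub_rev] at h2
    linarith [hδG x hxB hxc, min_le_left δ (1 / 16)]
  · exact hwP _ (hΦnear x hxB hxc) hPw

/-- **Invariance of domain**: a map that is continuous and injective on a neighbourhood of `p` maps
neighbourhoods of `p` to neighbourhoods of its value at `p`. -/
theorem image_mem_nhds_of_continuousOn_of_injOn {E : Type*} [NormedAddCommGroup E]
    [InnerProductSpace ℝ E] [FiniteDimensional ℝ E] {h : E → E} {s : Set E} {p : E}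
    (hs : s ∈ 𝓝 p) (hc : ContinuousOn h s) (hinj : InjOn h s) : h '' s ∈ 𝓝 (h p) := by
  obtain ⟨δ, hδ, hδs⟩ := Metric.nhds_basis_closedBall.mem_iff.1 hs
  have hmaps : MapsTo (fun x => p + δ • x) (Metric.closedBall (0 : E) 1) s := by
    intro x hx
    refine hδs ?_
    have hx' : ‖x‖ ≤ 1 := by simpa using hx
    rw [mem_closedBall_iff_norm, add_sub_cancel_left, norm_smul, Real.norm_of_nonneg hδ.le]
    nlinarith
  have hmem := mem_interior_image_unit_closedBall (h := fun x => h (p + δ • x))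
    (hc.comp (by fun_prop) hmaps)
    (hinj.comp (fun x _ y _ hxy => by simpa [hδ.ne'] using hxy) hmaps)
  have h1 := mem_interior_iff_mem_nhds.1 hmem
  simp only [smul_zero, add_zero] at h1
  refine mem_of_superset h1 ?_
  rintro _ ⟨x, hx, rfl⟩
  exact mem_image_of_mem h (hmaps hx)

/-! ### Separation when the convex hull-like property fails -/

/-- If `u` has upper limit below its supremum at every boundary point of a bounded open set `Ω`,
then a single level `r` below the supremum bounds `u` near the whole boundary. -/
theorem exists_level_of_limsup_ne_iSup {E : Type*} [PseudoMetricSpace E] [ProperSpace E]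
    {Ω : Set E} (hne : Ω.Nonempty) (hb : Bornology.IsBounded Ω) {u : E → ℝ}
    (h : ∀ x ∈ frontier Ω, limsup (fun y => ((u y : ℝ) : EReal)) (𝓝[Ω] x)
      ≠ ⨆ y ∈ Ω, ((u y : ℝ) : EReal)) :
    ∃ r : ℝ, (∃ x₀ ∈ Ω, r < u x₀) ∧
      ∀ x ∈ frontier Ω, ∀ᶠ y in 𝓝 x, y ∈ Ω → u y < r := by
  set S := ⨆ y ∈ Ω, ((u y : ℝ) : EReal) with hS
  have hcomp : IsCompact (frontier Ω) :=
    hb.isCompact_closure.of_isClosed_subset isClosed_frontier frontier_subset_closure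
  obtain ⟨r, hr, hev⟩ : ∃ r < S, ∀ x ∈ frontier Ω, ∀ᶠ y in 𝓝 x, y ∈ Ω →
      ((u y : ℝ) : EReal) < r := by
    refine hcomp.induction_on (p := fun s => ∃ r < S, ∀ x ∈ s, ∀ᶠ y in 𝓝 x, y ∈ Ω →
      ((u y : ℝ) : EReal) < r) ?_ ?_ ?_ ?_
    · obtain ⟨x, hx⟩ := hne
      exact ⟨⊥, (EReal.bot_lt_coe (u x)).trans_le (le_iSup₂_of_le x hx le_rfl), by simp⟩
    · rintro s t hst ⟨r, hr, h1⟩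
      exact ⟨r, hr, fun x hx => h1 x (hst hx)⟩
    · rintro s t ⟨r, hr, h1⟩ ⟨r', hr', h2⟩
      refine ⟨max r r', max_lt hr hr', ?_⟩
      rintro x (hx | hx)
      · filter_upwards [h1 x hx] with y hy hyΩ using (hy hyΩ).trans_le (le_max_left _ _)
      · filter_upwards [h2 x hx] with y hy hyΩ using (hy hyΩ).trans_le (le_max_right _ _)
    · intro x hx
      have hle : limsup (fun y => ((u y : ℝ) : EReal)) (𝓝[Ω] x) ≤ S :=
        limsup_le_of_le (h := eventually_mem_nhdsWithin.mono fun y hy => le_iSup₂_of_le y hy le_rfl)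
      obtain ⟨r, hr1, hr2⟩ := exists_between (lt_of_le_of_ne hle (h x hx))
      have h1 := eventually_nhdsWithin_iff.1 (eventually_lt_of_limsup_lt hr1)
      obtain ⟨t, ht, hto, hxt⟩ := eventually_nhds_iff.1 h1
      exact ⟨t, mem_nhdsWithin_of_mem_nhds (hto.mem_nhds hxt), r, hr2, fun z hz =>
        mem_of_superset (hto.mem_nhds hz) ht⟩
  obtain ⟨x₀, hx₀, hrx⟩ := lt_biSup_iff.1 hr
  obtain ⟨r', hr1, hr2⟩ := EReal.lt_iff_exists_real_btwn.1 hrx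
  refine ⟨r', ⟨x₀, hx₀, EReal.coe_lt_coe_iff.1 hr2⟩, fun x hx => ?_⟩
  filter_upwards [hev x hx] with y hy hyΩ
  exact EReal.coe_lt_coe_iff.1 ((hy hyΩ).trans hr1)

/-- If the convex hull-like property fails, then some linear functional separates a value of `f` at a
point of some open set `X` compactly contained in `Ω` from the values of `f` on the boundary
of `X`. The set `X` is a strict superlevel set of the quasi-convex function witnessing the
failure. -/
theorem exists_separating_functional_of_not_convexHullLike {E Y : Type*} [NormedAddCommGroup E]
    [NormedSpace ℝ E] [FiniteDimensional ℝ E] [Nontrivial E] [NormedAddCommGroup Y]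
    [NormedSpace ℝ Y] {Ω : Set E} (hΩ : IsOpen Ω) (hne : Ω.Nonempty)
    (hb : Bornology.IsBounded Ω) {f : E → Y} (hf : ContinuousOn f Ω)
    (h : ¬ ConvexHullLikeProperty Ω f) :
    ∃ X : Set E, IsOpen X ∧ X ⊆ Ω ∧ closure X ⊆ Ω ∧ ∃ (φ : StrongDual ℝ Y) (c : ℝ),
      (∃ v, 0 < φ v) ∧ (∃ x₀ ∈ X, c < φ (f x₀)) ∧ ∀ x ∈ frontier X, φ (f x) < c := by
  have : ProperSpace E := FiniteDimensional.proper ℝ E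
  have : NoncompactSpace E := NormedSpace.noncompactSpace ℝ E
  simp only [ConvexHullLikeProperty, not_forall, not_exists, not_and] at h
  obtain ⟨ψ, hψ, hqc, hlim⟩ := h
  obtain ⟨r, ⟨x₀, hx₀, hr⟩, hev⟩ := exists_level_of_limsup_ne_iSup hne hb
    (u := fun x => ψ (f x)) hlim
  have hψf : ContinuousOn (fun x => ψ (f x)) Ω := hψ.comp_continuousOn hf
  set X := {x ∈ Ω | r < ψ (f x)} with hX
  have hXo : IsOpen X := hψf.isOpen_inter_preimage hΩ isOpen_Ioi
  have hXΩ : X ⊆ Ω := fun x hx => hx.1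
  have hcl : closure X ⊆ Ω := by
    intro x hx
    by_contra hxΩ
    have hxf : x ∈ frontier Ω := by
      rw [hΩ.frontier_eq]
      exact ⟨closure_mono hXΩ hx, hxΩ⟩
    obtain ⟨y, hy1, hy2⟩ := mem_closure_iff_nhds.1 hx _ (hev x hxf)
    exact lt_asymm hy2.2 (hy1 hy2.1)
  have hfr : ∀ x ∈ frontier X, ψ (f x) ≤ r := by
    intro x hx
    rw [hXo.frontier_eq] at hx
    by_contra! hlt
    exact hx.2 ⟨hcl hx.1, hlt⟩
  obtain ⟨φ, c, hφ1, hφ2⟩ := geometric_hahn_banach_closed_point (s := {y | ψ y ≤ r}) (x := f x₀)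
    (by simpa using hqc r) (isClosed_le hψ continuous_const) (not_le.2 hr)
  have hXb : Bornology.IsBounded X := hb.subset hXΩ
  obtain ⟨z, hz⟩ : (frontier X).Nonempty := nonempty_frontier_iff.2 ⟨⟨x₀, hx₀, hr⟩, fun hu =>
    noncompact_univ E (by simpa [hu] using hXb.isCompact_closure)⟩
  refine ⟨X, hXo, hXΩ, hcl, φ, c, ⟨f x₀ - f z, ?_⟩, ⟨x₀, ⟨hx₀, hr⟩, hφ2⟩, fun x hx =>
    hφ1 _ (hfr x hx)⟩
  rw [map_sub]
  linarith [hφ1 _ (hfr z hz)]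

/-! ### Singular points -/

/-- Adding a bounded perturbation to a large multiple of `f` does not destroy a strict separation
between the value at `x₀` and the values on the boundary, so the functional `φ` attains its maximum
over `closure X` at a point of `X`. -/
theorem exists_forall_gt_exists_isMaxOn {E Y : Type*} [TopologicalSpace E] [NormedAddCommGroup Y]
    [NormedSpace ℝ Y] {X : Set E} (hX : IsOpen X) (hcomp : IsCompact (closure X)) {f g : E → Y}
    (hf : ContinuousOn f (closure X)) (hg : ContinuousOn g (closure X)) {φ : StrongDual ℝ Y}
    {c : ℝ} {x₀ : E} (hx₀ : x₀ ∈ X) (hc : c < φ (f x₀))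
    (hfr : ∀ x ∈ frontier X, φ (f x) < c) :
    ∃ lam₀ : ℝ, 0 ≤ lam₀ ∧ ∀ lam, lam₀ < lam →
      ∃ p ∈ X, IsMaxOn (fun x => φ (g x + lam • f x)) X p := by
  obtain ⟨M, hM⟩ := hcomp.exists_bound_of_continuousOn (φ.continuous.comp_continuousOn hg)
  have hM' : ∀ x ∈ closure X, |φ (g x)| ≤ M := hM
  have hM0 : 0 ≤ M := (abs_nonneg _).trans (hM' x₀ (subset_closure hx₀))
  have hd : 0 < φ (f x₀) - c := sub_pos.2 hc
  refine ⟨2 * M / (φ (f x₀) - c), by positivity, fun lam hlam => ?_⟩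
  have hlam0 : 0 < lam := lt_of_le_of_lt (by positivity) hlam
  rw [div_lt_iff₀ hd] at hlam
  obtain ⟨p, hp, hmax⟩ := hcomp.exists_isMaxOn ⟨x₀, subset_closure hx₀⟩
    (φ.continuous.comp_continuousOn (hg.add (hf.const_smul lam)))
  refine ⟨p, ?_, fun x hx => hmax (subset_closure hx)⟩
  by_contra hpX
  have hpf : p ∈ frontier X := by
    rw [hX.frontier_eq]
    exact ⟨hp, hpX⟩
  have h1 : φ (g x₀ + lam • f x₀) ≤ φ (g p + lam • f p) := hmax (subset_closure hx₀)
  simp only [map_add, map_smul, smul_eq_mul] at h1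
  have h2 := abs_le.1 (hM' x₀ (subset_closure hx₀))
  have h3 := abs_le.1 (hM' p hp)
  nlinarith [hfr p hpf]

/-- Where a nonzero linear functional of `h` is maximal over the open set `X`, values near `h p` are
missed, and, by invariance of domain, `h` is not injective in any neighbourhood of `p`. -/
theorem exists_seq_of_isMaxOn {E : Type*} [NormedAddCommGroup E] [InnerProductSpace ℝ E]
    [FiniteDimensional ℝ E] {X : Set E} (hX : IsOpen X) {h : E → E} (hh : ContinuousOn h X)
    {φ : StrongDual ℝ E} {v : E} (hv : 0 < φ v) {p : E} (hp : p ∈ X)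
    (hmax : IsMaxOn (fun x => φ (h x)) X p) :
    ∃ y z : ℕ → E, Tendsto y atTop (𝓝 (h p)) ∧ Tendsto z atTop (𝓝 (h p)) ∧
      (∀ k, ¬ ∃ x ∈ X, h x = y k) ∧ ∃ a b : ℕ → E,
        (∀ k, a k ∈ X ∧ b k ∈ X ∧ a k ≠ b k ∧ h (a k) = z k ∧ h (b k) = z k) ∧
        Tendsto a atTop (𝓝 p) ∧ Tendsto b atTop (𝓝 p) := by
  set y : ℕ → E := fun k => h p + (1 / ((k : ℝ) + 1)) • v with hy
  have hyt : Tendsto y atTop (𝓝 (h p)) := by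
    have := (tendsto_one_div_add_atTop_nhds_zero_nat (𝕜 := ℝ)).smul_const v
    simpa [hy] using this.const_add (h p)
  have hyX : ∀ k, ¬ ∃ x ∈ X, h x = y k := by
    rintro k ⟨x, hx, hxy⟩
    have h1 : φ (h x) ≤ φ (h p) := hmax hx
    rw [hxy] at h1
    simp only [hy, map_add, map_smul, smul_eq_mul] at h1
    have : 0 < 1 / ((k : ℝ) + 1) * φ v := by positivity
    linarith
  have hnot : ∀ s ∈ 𝓝 p, s ⊆ X → ¬ InjOn h s := by
    intro s hs hsX hinj
    have h1 := image_mem_nhds_of_continuousOn_of_injOn hs (hh.mono hsX) hinj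
    obtain ⟨k, x, hx, hxy⟩ := (hyt.eventually h1).exists
    exact hyX k ⟨x, hsX hx, hxy⟩
  have hpair : ∀ k : ℕ, ∃ a b, a ∈ X ∧ b ∈ X ∧ a ≠ b ∧ h a = h b ∧
      dist a p < 1 / ((k : ℝ) + 1) ∧ dist b p < 1 / ((k : ℝ) + 1) := by
    intro k
    have h1 := hnot (X ∩ Metric.ball p (1 / ((k : ℝ) + 1)))
      (inter_mem (hX.mem_nhds hp) (Metric.ball_mem_nhds p (by positivity))) inter_subset_left
    simp only [InjOn, not_forall] at h1
    obtain ⟨a, ha, b, hb, hab, hne⟩ := h1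
    exact ⟨a, b, ha.1, hb.1, hne, hab, ha.2, hb.2⟩
  choose a b ha hb hne hab hda hdb using hpair
  have hlim : ∀ c : ℕ → E, (∀ k, dist (c k) p < 1 / ((k : ℝ) + 1)) → Tendsto c atTop (𝓝 p) :=
    fun c hc => tendsto_iff_dist_tendsto_zero.2 (squeeze_zero (fun _ => dist_nonneg)
      (fun k => (hc k).le) tendsto_one_div_add_atTop_nhds_zero_nat)
  exact ⟨y, fun k => h (a k), hyt, ((hh.continuousAt (hX.mem_nhds hp)).tendsto.comp (hlim a hda)),
    hyX, a, b, fun k => ⟨ha k, hb k, hne k, rfl, (hab k).symm⟩, hlim a hda, hlim b hdb⟩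
theorem theorem2 (n : ℕ) (hn : 1 ≤ n)
    (Ω : Set (EuclideanSpace ℝ (Fin n))) (hΩ_open : IsOpen Ω) (hΩ_ne : Ω.Nonempty)
    (hΩ_bdd : Bornology.IsBounded Ω)
    (f : EuclideanSpace ℝ (Fin n) → EuclideanSpace ℝ (Fin n)) (hf : ContinuousOn f Ω) :
    ConvexHullLikeProperty Ω f ∨
    ∃ X : Set (EuclideanSpace ℝ (Fin n)), IsOpen X ∧ X.Nonempty ∧ X ⊆ Ω ∧ closure X ⊆ Ω ∧
      ∀ g : EuclideanSpace ℝ (Fin n) → EuclideanSpace ℝ (Fin n), ContinuousOn g Ω →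
        ∃ lam₀ : ℝ, 0 ≤ lam₀ ∧ ∀ lam : ℝ, lam₀ < lam →
          ∃ xhat ∈ X, ∃ y z : ℕ → EuclideanSpace ℝ (Fin n),
            Tendsto y atTop (𝓝 (g xhat + lam • f xhat)) ∧
            Tendsto z atTop (𝓝 (g xhat + lam • f xhat)) ∧
            (∀ k, ¬ ∃ x ∈ X, g x + lam • f x = y k) ∧
            ∃ u v : ℕ → EuclideanSpace ℝ (Fin n),
              (∀ k, u k ∈ X ∧ v k ∈ X ∧ u k ≠ v k ∧
                g (u k) + lam • f (u k) = z k ∧ g (v k) + lam • f (v k) = z k) ∧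
              Tendsto u atTop (𝓝 xhat) ∧ Tendsto v atTop (𝓝 xhat) := by
  rw [or_iff_not_imp_left]
  intro hnot
  have : NeZero n := ⟨by omega⟩
  obtain ⟨X, hXo, hXΩ, hcl, φ, c, ⟨v, hv⟩, ⟨x₀, hx₀, hc⟩, hfr⟩ :=
    exists_separating_functional_of_not_convexHullLike hΩ_open hΩ_ne hΩ_bdd hf hnot
  refine ⟨X, hXo, ⟨x₀, hx₀⟩, hXΩ, hcl, fun g hg => ?_⟩
  obtain ⟨lam₀, h0, hlam⟩ := exists_forall_gt_exists_isMaxOn hXo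
    (hΩ_bdd.subset hXΩ).isCompact_closure (hf.mono hcl) (hg.mono hcl) hx₀ hc hfr
  refine ⟨lam₀, h0, fun lam hlt => ?_⟩
  obtain ⟨p, hp, hmax⟩ := hlam lam hlt
  exact ⟨p, hp, exists_seq_of_isMaxOn hXo ((hg.add (hf.const_smul lam)).mono hXΩ) hv hp hmax⟩
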